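/- Let $m=2$, and on the index set $\{1,\dots,5\}$ put $i'=6-i$, $\bar\imath=0$ if $i=3$ and $\bar\imath=1$ otherwise, $\theta_1=\theta_2=\theta_3=1$, $\theta_4=\theta_5=-1$, $\kappa=-5/2$. The extended Yangian $\mathrm{X}(\mathfrak{osp}_{1|4})$ is the $\mathbb Z_2$-graded associative unital algebra over $\mathbb C$ generated by elements $t_{ij}^{(r)}$ of parity $\bar\imath+\bar\jmath \bmod 2$ $(1\le i,j\le 5,\ r\ge 1)$, subject to the relations, for the series $t_{ij}(u)=\delta_{ij}+\sum_{r\ge1}t_{ij}^{(r)}u^{-r}$, $$\begin{aligned}{}[t_{ij}(u),t_{kl}(v)]&=\frac{1}{u-v}\big(t_{kj}(u)t_{il}(v)-t_{kj}(v)t_{il}(u)\big)(-1)^{\bar\imath\bar\jmath+\bar\imath\bar k+\bar\jmath\bar k}\\&\quad-\frac{1}{u-v-\kappa}\Big(\delta_{ki'}\sum_{p=1}^{5}t_{pj}(u)t_{p'l}(v)(-1)^{\bar\imath+\bar\imath\bar\jmath+\bar\jmath\bar p}\theta_i\theta_p-\delta_{lj'}\sum_{p=1}^{5}t_{kp'}(v)t_{ip}(u)(-1)^{\bar\imath\bar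 k+\bar\jmath\bar k+\bar\imath\bar p}\theta_{j'}\theta_{p'}\Big),\end{aligned}$$ where $[a,b]=ab-(-1)^{p(a)p(b)}ba$ is the super-commutator of homogeneous elements. Let $T(u)=[t_{ij}(u)]=F(u)H(u)E(u)$ be the unique factorization with $F(u)$ lower unitriangular, $H(u)$ diagonal and $E(u)=[e_{ij}(u)]$ upper unitriangular, and write $e_{ij}(u)=\sum_{r\ge1}e_{ij}^{(r)}u^{-r}$ for $i<j$. Then in $\mathrm{X}(\mathfrak{osp}_{1|4})$ (as identities of formal power series in $v^{-1}$, respectively in $u^{-1},v^{-1}$, where $g(v-3/2)$ is expanded in powers of $v^{-1}$) $$[e_{12}^{(1)},e_{22'}(v)]=e_{12}(v)e_{22'}(v)-e_{12'}(v)-e_{12'}(v-\tfrac32)+e_{23}(v)e_{13}(v-\tfrac32)+e_{22'}(v)e_{12}(v-\tfrac32)$$ and $$\begin{aligned}{}[e_{12}(u),e_{22'}(v)]&=-\frac{e_{12}(u)-e_{12}(v)}{u-v}\,e_{22'}(v)+\frac{e_{12'}(u)-e_{12'}(v)}{u-v}+\frac{e_{12'}(u)-e_{12'}(v-\frac32)}{u-v+\frac32}\\&\quad-e_{23}(v)\frac{e_{13}(u)-e_{13}(v-\frac32)}{u-v+\frac32}-e_{22'}(v)\frac{e_{12}(u)-e_{12}(v-\frac32)}{u-v+\frac32}.\end{aligned}$$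 -/

import Mathlib

open PowerSeries

noncomputable section

namespace OspYangian

/-! ### Formal series in `u⁻¹` and in `u⁻¹, v⁻¹`

A series in `u⁻¹` with coefficients in `A` is an element of `A⟦X⟧`, the variable `X` standing for
`u⁻¹`.  A series in `u⁻¹, v⁻¹` is an element of `A⟦X⟧⟦X⟧`: the coefficient of `u⁻ʳ v⁻ˢ` in `f` is
`coeff s (coeff r f)`, so the outer variable is `u⁻¹` and the inner one is `v⁻¹`. -/

section Series

variable {A : Type*} [Ring A] [Algebra ℂ A]

/-- `g(u)`, as a series in `u⁻¹, v⁻¹`. -/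
def atU (g : A⟦X⟧) : A⟦X⟧⟦X⟧ := PowerSeries.map (C : A →+* A⟦X⟧) g

/-- `g(v)`, as a series in `u⁻¹, v⁻¹`. -/
def atV (g : A⟦X⟧) : A⟦X⟧⟦X⟧ := C g

/-- The monomial `u⁻¹ v⁻¹`. -/
def monUV (A : Type*) [Ring A] : A⟦X⟧⟦X⟧ := X * C X

/-- `u⁻¹ v⁻¹ (u - v - c) = v⁻¹ - u⁻¹ - c u⁻¹ v⁻¹`. -/
def linUV (A : Type*) [Ring A] [Algebra ℂ A] (c : ℂ) : A⟦X⟧⟦X⟧ :=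
  C X - X - c • monUV A

/-- The expansion `u⁻¹ / (1 + c u⁻¹)` of `(u + c)⁻¹` as a series in `u⁻¹`. -/
def shiftVar (c : ℂ) : ℂ⟦X⟧ := X * (1 + c • X)⁻¹

/-- The series `g(u + c) = ∑ᵣ gᵣ (u + c)⁻ʳ`, re-expanded in powers of `u⁻¹`.  The series
`(u + c)⁻ʳ` only contributes to the coefficients of `u⁻ⁿ` with `n ≥ r`. -/
def shift (c : ℂ) (g : A⟦X⟧) : A⟦X⟧ :=
  PowerSeries.mk fun n => ∑ r ∈ Finset.range (n + 1), coeff n (shiftVar c ^ r) • coeff r g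

/-- The series `(g(u) - g(v)) / (u - v) = - ∑_{r, s ≥ 1} g_{r+s-1} u⁻ʳ v⁻ˢ`. -/
def divDiff₀ (g : A⟦X⟧) : A⟦X⟧⟦X⟧ :=
  PowerSeries.mk fun r => PowerSeries.mk fun s =>
    if r = 0 ∨ s = 0 then 0 else - coeff (r + s - 1) g

/-- The series `(g(u) - g(v + c)) / (u - v - c)` in `u⁻¹, v⁻¹`: the replacement of `v` by `v + c`
in the previous series.  It is characterized by the identity proved in `linUV_mul_divDiff`. -/
def divDiff (c : ℂ) (g : A⟦X⟧) : A⟦X⟧⟦X⟧ :=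
  PowerSeries.mk fun r => shift c (coeff r (divDiff₀ g))

theorem shiftVar_mul (c : ℂ) : (1 + c • X) * shiftVar c = (X : ℂ⟦X⟧) := by
  have h : constantCoeff (1 + c • X : ℂ⟦X⟧) ≠ 0 := by simp
  rw [shiftVar, mul_left_comm, PowerSeries.mul_inv_cancel _ h, mul_one]

theorem coeff_shiftVar_pow_of_lt (c : ℂ) {n r : ℕ} (h : n < r) : coeff n (shiftVar c ^ r) = 0 := by
  rw [shiftVar, mul_pow, coeff_X_pow_mul', if_neg (by omega)]

theorem X_mul_shift (c : ℂ) (g : A⟦X⟧) :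
    X * shift c g = (1 + c • X) * shift c (X * g) := by
  have key : ∀ n, coeff n (shift c (X * g)) =
      ∑ r ∈ Finset.range n, coeff n (shiftVar c ^ (r + 1)) • coeff r g := by
    intro n
    rw [shift, coeff_mk, Finset.sum_range_succ']
    simp [coeff_succ_X_mul]
  ext n
  cases n with
  | zero =>
    have h0 := key 0
    simp only [coeff_zero_eq_constantCoeff, Finset.range_zero, Finset.sum_empty] at h0
    simp [add_mul, h0]
  | succ k =>
    rw [coeff_succ_X_mul, add_mul, one_mul, smul_mul_assoc, map_add, key, coeff_smul,
      coeff_succ_X_mul, key, shift, coeff_mk]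
    have h2 : ∑ r ∈ Finset.range k, coeff k (shiftVar c ^ (r + 1)) • coeff r g =
        ∑ r ∈ Finset.range (k + 1), coeff k (shiftVar c ^ (r + 1)) • coeff r g := by
      rw [Finset.sum_range_succ, coeff_shiftVar_pow_of_lt c (Nat.lt_succ_self k), zero_smul,
        add_zero]
    rw [h2, Finset.smul_sum, ← Finset.sum_add_distrib]
    refine Finset.sum_congr rfl fun r _ => ?_
    rw [smul_smul, ← add_smul]
    congr 1
    have h3 : X * shiftVar c ^ r = (1 + c • X) * shiftVar c ^ (r + 1) := by
      rw [pow_succ', ← mul_assoc, shiftVar_mul]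
    have h4 := congrArg (coeff (k + 1)) h3
    rw [coeff_succ_X_mul, add_mul, one_mul, smul_mul_assoc, map_add, coeff_smul,
      coeff_succ_X_mul] at h4
    exact h4

theorem shift_add (c : ℂ) (f g : A⟦X⟧) : shift c (f + g) = shift c f + shift c g := by
  ext n
  simp [shift, Finset.sum_add_distrib]

theorem shift_C (c : ℂ) (a : A) : shift c (C a) = C a := by
  ext n
  rw [shift, coeff_mk, Finset.sum_range_succ']
  simp only [pow_zero, coeff_C, coeff_one]
  by_cases h : n = 0 <;> simp [h]

theorem shift_zero (c : ℂ) : shift c (0 : A⟦X⟧) = 0 := by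
  ext n
  simp [shift]

/-- `(u - v - c) · divDiff c g = g(u) - g(v + c)`, multiplied by `u⁻¹ v⁻¹`. -/
theorem linUV_mul_divDiff (c : ℂ) (g : A⟦X⟧) :
    linUV A c * divDiff c g = monUV A * (atU g - atV (shift c g)) := by
  have hd : ∀ k, X * coeff (k + 1) (divDiff₀ g) + (if k = 0 then X * g else 0) =
      coeff k (divDiff₀ g) + X * C (coeff k g) := by
    intro k
    ext s
    rcases s with _ | s
    · rcases k with _ | k <;> simp [divDiff₀]
    · rcases k with _ | k
      · rcases s with _ | s
        · simp [divDiff₀, coeff_succ_X_mul]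
        · simp [divDiff₀, coeff_succ_X_mul, coeff_X]
      · rcases s with _ | s
        · simp [divDiff₀, coeff_succ_X_mul]
        · simp [divDiff₀, coeff_succ_X_mul, coeff_X,
            show k + 1 + (s + 1) = k + (s + 1 + 1) by omega]
  have hm : ∀ f : A⟦X⟧⟦X⟧, monUV A * f = X * (C X * f) := fun f => by rw [monUV, mul_assoc]
  have hl : ∀ f : A⟦X⟧⟦X⟧, linUV A c * f = C X * f - X * f - X * (c • (C X * f)) := fun f => by
    rw [linUV, sub_mul, sub_mul, smul_mul_assoc, hm, mul_smul_comm]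
  ext1 r
  rw [hl, hm]
  rcases r with _ | k
  · have h0 : coeff 0 (divDiff₀ g) = 0 := by
      ext s
      simp [divDiff₀]
    have h1 : coeff 0 (divDiff c g) = 0 := by rw [divDiff, coeff_mk, h0, shift_zero]
    simp only [map_sub, coeff_C_mul, coeff_zero_X_mul, h1, mul_zero, sub_zero]
  · simp only [map_sub, coeff_C_mul, coeff_succ_X_mul]
    have e1 : coeff k (c • (C X * divDiff c g)) = c • (X * coeff k (divDiff c g)) := by
      rw [← coeff_C_mul]
      rfl
    have e2 : coeff k (atU g) = C (coeff k g) := by rw [atU, coeff_map]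
    have e3 : coeff k (atV (shift c g)) = if k = 0 then shift c g else 0 := by
      rw [atV, coeff_C]
    have e4 : ∀ k, coeff k (divDiff c g) = shift c (coeff k (divDiff₀ g)) := fun k => by
      rw [divDiff, coeff_mk]
    have e5 := congrArg (fun f => (1 + c • X) * shift c f) (hd k)
    simp only [shift_add, mul_add, ← X_mul_shift, shift_C] at e5
    have e6 : (1 + c • X) * shift c (if k = 0 then X * g else 0) =
        X * (if k = 0 then shift c g else 0) := by
      split_ifs
      · rw [X_mul_shift]
      · rw [shift_zero, mul_zero, mul_zero]
    rw [e6, add_mul, one_mul, smul_mul_assoc] at e5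
    rw [e1, e2, e3, e4, e4, mul_sub, sub_sub, sub_eq_sub_iff_add_eq_add, e5]
    abel

end Series

section Maps

variable {A B : Type*} [Ring A] [Algebra ℂ A] [Ring B] [Algebra ℂ B] (φ : A →ₐ[ℂ] B)

theorem map_atU (g : A⟦X⟧) :
    PowerSeries.map (PowerSeries.map (φ : A →+* B)) (atU g) =
      atU (PowerSeries.map (φ : A →+* B) g) := by
  ext r s
  simp [atU]

theorem map_atV (g : A⟦X⟧) :
    PowerSeries.map (PowerSeries.map (φ : A →+* B)) (atV g) =
      atV (PowerSeries.map (φ : A →+* B) g) := by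
  simp [atV]

theorem map_monUV :
    PowerSeries.map (PowerSeries.map (φ : A →+* B)) (monUV A) = monUV B := by
  simp [monUV]

theorem map_linUV (c : ℂ) :
    PowerSeries.map (PowerSeries.map (φ : A →+* B)) (linUV A c) = linUV B c := by
  have h : PowerSeries.map (PowerSeries.map (φ : A →+* B)) (c • monUV A) = c • monUV B := by
    rw [← map_monUV φ]
    ext r s
    simp only [coeff_map]
    exact map_smul φ c _
  simp [linUV, h]

end Maps

theorem atU_zsmul {A : Type*} [Ring A] (z : ℤ) (g : A⟦X⟧) : atU (z • g) = z • atU g := map_zsmul _ _ _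

theorem atV_zsmul {A : Type*} [Ring A] (z : ℤ) (g : A⟦X⟧) : atV (z • g) = z • atV g := map_zsmul _ _ _

theorem coeff_zsmul' {A : Type*} [Ring A] (z : ℤ) (g : A⟦X⟧) (n : ℕ) : z • coeff n g = coeff n (z • g) :=
  (map_zsmul _ _ _).symm

/-! ### The extended Yangian -/

section Yangian

/-- The parity `ī` of the index `i`.  The indices `1, …, 2m+1` are numbered from `0` here, and the
involution `i ↦ i'` is `Fin.rev`. -/
def bar (m : ℕ) (i : Fin (2 * m + 1)) : ℕ := if i.val = m then 0 else 1

/-- The sign `θ_i`. -/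
def theta (m : ℕ) (i : Fin (2 * m + 1)) : ℤ := if i.val ≤ m then 1 else -1

/-- The parameter `κ = -m - 1/2`. -/
def kappa (m : ℕ) : ℂ := -(m : ℂ) - 1 / 2

variable {A : Type*} [Ring A] [Algebra ℂ A]

/-- The left hand side
`(u-v) (u-v-κ) [t_ij(u), t_kl(v)]`, multiplied by `u⁻² v⁻²`, of the defining relations. -/
def relLHS (m : ℕ) (t : Fin (2 * m + 1) → Fin (2 * m + 1) → A⟦X⟧) (i j k l : Fin (2 * m + 1)) :
    A⟦X⟧⟦X⟧ :=
  linUV A 0 * linUV A (kappa m) *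
    (atU (t i j) * atV (t k l) -
      ((-1 : ℤ) ^ ((bar m i + bar m j) * (bar m k + bar m l))) • (atV (t k l) * atU (t i j)))

/-- The right hand side of the defining relations,
`(u-v-κ) (t_kj(u) t_il(v) - t_kj(v) t_il(u)) (-1)^{īj̄ + īk̄ + j̄k̄}`
`- (u-v) (δ_{k i'} ∑_p t_pj(u) t_p'l(v) (-1)^{ī + īj̄ + j̄p̄} θ_i θ_p`
`- δ_{l j'} ∑_p t_kp'(v) t_ip(u) (-1)^{īk̄ + j̄k̄ + īp̄} θ_j' θ_p')`,
multiplied by `u⁻² v⁻²`. -/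
def relRHS (m : ℕ) (t : Fin (2 * m + 1) → Fin (2 * m + 1) → A⟦X⟧) (i j k l : Fin (2 * m + 1)) :
    A⟦X⟧⟦X⟧ :=
  monUV A * linUV A (kappa m) *
      (((-1 : ℤ) ^ (bar m i * bar m j + bar m i * bar m k + bar m j * bar m k)) •
        (atU (t k j) * atV (t i l) - atV (t k j) * atU (t i l))) -
    monUV A * linUV A 0 *
      ((if k = i.rev then
          ∑ p, ((-1 : ℤ) ^ (bar m i + bar m i * bar m j + bar m j * bar m p) *
            theta m i * theta m p) • (atU (t p j) * atV (t p.rev l))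
        else 0) -
       (if l = j.rev then
          ∑ p, ((-1 : ℤ) ^ (bar m i * bar m k + bar m j * bar m k + bar m i * bar m p) *
            theta m j.rev * theta m p.rev) • (atV (t k p.rev) * atU (t i p))
        else 0))

/-- The free algebra on symbols `(i, j, r)`; the symbol `(i, j, r)` stands for `t_ij^{(r+1)}`. -/
abbrev FreeT (m : ℕ) : Type := FreeAlgebra ℂ (Fin (2 * m + 1) × Fin (2 * m + 1) × ℕ)

/-- The series `δ_ij + ∑_{r ≥ 1} t_ij^{(r)} u⁻ʳ` over the free algebra. -/
def freeT (m : ℕ) (i j : Fin (2 * m + 1)) : (FreeT m)⟦X⟧ :=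
  PowerSeries.mk fun r =>
    match r with
    | 0 => if i = j then 1 else 0
    | r + 1 => FreeAlgebra.ι ℂ (i, j, r)

/-- The defining relations: equality of all coefficients on both sides. -/
inductive Rel (m : ℕ) : FreeT m → FreeT m → Prop
  | mk (i j k l : Fin (2 * m + 1)) (r s : ℕ) :
      Rel m (coeff s (coeff r (relLHS m (freeT m) i j k l)))
        (coeff s (coeff r (relRHS m (freeT m) i j k l)))

/-- The extended Yangian `X(osp_{1|2m})`. -/
abbrev XOsp (m : ℕ) : Type := RingQuot (Rel m)

/-- The quotient map from the free algebra. -/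
def proj (m : ℕ) : FreeT m →ₐ[ℂ] XOsp m := RingQuot.mkAlgHom ℂ (Rel m)

/-- The series `t_ij(u)` over `X(osp_{1|2m})`. -/
def tSer (m : ℕ) (i j : Fin (2 * m + 1)) : (XOsp m)⟦X⟧ :=
  PowerSeries.map (proj m : FreeT m →+* XOsp m) (freeT m i j)

/-- The generator matrix `T(u)`. -/
def tMat (m : ℕ) : Matrix (Fin (2 * m + 1)) (Fin (2 * m + 1)) (XOsp m)⟦X⟧ :=
  Matrix.of (tSer m)

end Yangian

/-! ### The `ℤ/2`-grading and the super-commutator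

The grading on `X(osp_{1|2m})`, in which `t_ij^{(r)}` has parity `ī + j̄`, is encoded by its
parity automorphism, equal to `(-1)^p` on the component of parity `p`. -/

section Grading

variable (m : ℕ)

/-- The map `t_ij^{(r)} ↦ (-1)^{ī + j̄} t_ij^{(r)}` from the free algebra to `X(osp_{1|2m})`. -/
def preParity : FreeT m →ₐ[ℂ] XOsp m :=
  FreeAlgebra.lift ℂ fun x =>
    ((-1 : ℤ) ^ (bar m x.1 + bar m x.2.1)) • proj m (FreeAlgebra.ι ℂ x)

theorem bar_rev (i : Fin (2 * m + 1)) : bar m i.rev = bar m i := by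
  have hi := i.isLt
  have h : i.rev.val = m ↔ i.val = m := by
    rw [Fin.val_rev]
    omega
  simp only [bar, h]

theorem relLHS_map {A B : Type*} [Ring A] [Algebra ℂ A] [Ring B] [Algebra ℂ B] (φ : A →ₐ[ℂ] B)
    (t : Fin (2 * m + 1) → Fin (2 * m + 1) → A⟦X⟧) (i j k l : Fin (2 * m + 1)) :
    PowerSeries.map (PowerSeries.map (φ : A →+* B)) (relLHS m t i j k l) =
      relLHS m (fun i j => PowerSeries.map (φ : A →+* B) (t i j)) i j k l := by
  simp only [relLHS, map_mul, map_sub, map_zsmul, map_atU, map_atV, map_linUV]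

theorem relRHS_map {A B : Type*} [Ring A] [Algebra ℂ A] [Ring B] [Algebra ℂ B] (φ : A →ₐ[ℂ] B)
    (t : Fin (2 * m + 1) → Fin (2 * m + 1) → A⟦X⟧) (i j k l : Fin (2 * m + 1)) :
    PowerSeries.map (PowerSeries.map (φ : A →+* B)) (relRHS m t i j k l) =
      relRHS m (fun i j => PowerSeries.map (φ : A →+* B) (t i j)) i j k l := by
  simp only [relRHS, map_mul, map_sub, map_zsmul, map_atU, map_atV, map_linUV, map_monUV,
    apply_ite (PowerSeries.map (PowerSeries.map (φ : A →+* B))), map_sum, map_zero]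

theorem relLHS_twist {A : Type*} [Ring A] [Algebra ℂ A]
    (t : Fin (2 * m + 1) → Fin (2 * m + 1) → A⟦X⟧) (i j k l : Fin (2 * m + 1)) :
    relLHS m (fun i j => ((-1 : ℤ) ^ (bar m i + bar m j)) • t i j) i j k l =
      ((-1 : ℤ) ^ (bar m i + bar m j + bar m k + bar m l)) • relLHS m t i j k l := by
  simp only [relLHS, atU_zsmul, atV_zsmul, smul_mul_assoc, smul_smul, ← pow_add, ← mul_smul_comm,
    smul_sub]
  congr 3
  · ring_nf
  · ring_nf

theorem sign_rev (i j l p : Fin (2 * m + 1)) :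
    (-1 : ℤ) ^ (bar m p + bar m j) * (-1 : ℤ) ^ (bar m p.rev + bar m l) =
      (-1 : ℤ) ^ (bar m i + bar m j + bar m i.rev + bar m l) := by
  rw [bar_rev, bar_rev, ← pow_add,
    show bar m p + bar m j + (bar m p + bar m l) = 2 * bar m p + (bar m j + bar m l) by ring,
    show bar m i + bar m j + bar m i + bar m l = 2 * bar m i + (bar m j + bar m l) by ring,
    pow_add _ (2 * bar m p), pow_add _ (2 * bar m i), pow_mul, pow_mul, neg_one_sq, one_pow,
    one_pow]

theorem relRHS_twist {A : Type*} [Ring A] [Algebra ℂ A]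
    (t : Fin (2 * m + 1) → Fin (2 * m + 1) → A⟦X⟧) (i j k l : Fin (2 * m + 1)) :
    relRHS m (fun i j => ((-1 : ℤ) ^ (bar m i + bar m j)) • t i j) i j k l =
      ((-1 : ℤ) ^ (bar m i + bar m j + bar m k + bar m l)) • relRHS m t i j k l := by
  have uv : ∀ (a b : ℤ) (x y : A⟦X⟧), atU (a • x) * atV (b • y) = (a * b) • (atU x * atV y) := by
    intro a b x y
    rw [atU_zsmul, atV_zsmul, smul_mul_smul_comm]
  have vu : ∀ (a b : ℤ) (x y : A⟦X⟧), atV (a • x) * atU (b • y) = (a * b) • (atV x * atU y) := by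
    intro a b x y
    rw [atU_zsmul, atV_zsmul, smul_mul_smul_comm]
  have s1 : (-1 : ℤ) ^ (bar m k + bar m j) * (-1 : ℤ) ^ (bar m i + bar m l) =
      (-1 : ℤ) ^ (bar m i + bar m j + bar m k + bar m l) := by
    rw [← pow_add]
    congr 1
    ring
  simp only [relRHS, uv, vu, s1]
  set ε : ℤ := (-1 : ℤ) ^ (bar m i + bar m j + bar m k + bar m l) with hε
  have q1 : (if k = i.rev then
        ∑ p, ((-1 : ℤ) ^ (bar m i + bar m i * bar m j + bar m j * bar m p) *
          theta m i * theta m p) • ((-1 : ℤ) ^ (bar m p + bar m j) *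
            (-1 : ℤ) ^ (bar m p.rev + bar m l)) • (atU (t p j) * atV (t p.rev l)) else 0) =
      ε • (if k = i.rev then
        ∑ p, ((-1 : ℤ) ^ (bar m i + bar m i * bar m j + bar m j * bar m p) *
          theta m i * theta m p) • (atU (t p j) * atV (t p.rev l)) else 0) := by
    split_ifs with h
    · subst h
      rw [Finset.smul_sum]
      refine Finset.sum_congr rfl fun p _ => ?_
      rw [sign_rev m i, smul_comm]
    · rw [smul_zero]
  have q2 : (if l = j.rev then
        ∑ p, ((-1 : ℤ) ^ (bar m i * bar m k + bar m j * bar m k + bar m i * bar m p) *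
          theta m j.rev * theta m p.rev) • ((-1 : ℤ) ^ (bar m k + bar m p.rev) *
            (-1 : ℤ) ^ (bar m i + bar m p)) • (atV (t k p.rev) * atU (t i p)) else 0) =
      ε • (if l = j.rev then
        ∑ p, ((-1 : ℤ) ^ (bar m i * bar m k + bar m j * bar m k + bar m i * bar m p) *
          theta m j.rev * theta m p.rev) • (atV (t k p.rev) * atU (t i p)) else 0) := by
    split_ifs with h
    · subst h
      rw [Finset.smul_sum]
      refine Finset.sum_congr rfl fun p _ => ?_
      have h3 : (-1 : ℤ) ^ (bar m k + bar m p.rev) * (-1 : ℤ) ^ (bar m i + bar m p) = ε := by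
        have h4 := sign_rev m j i k p
        rw [hε, mul_comm, add_comm (bar m i), add_comm (bar m k), h4]
        congr 1
        ring
      rw [h3, smul_comm]
    · rw [smul_zero]
  rw [q1, q2, ← smul_sub, ← smul_sub, smul_comm _ ε,
    mul_smul_comm ε (monUV A * linUV A (kappa m)), mul_smul_comm ε (monUV A * linUV A 0), ← smul_sub]

theorem relLHS_tSer (i j k l : Fin (2 * m + 1)) :
    relLHS m (tSer m) i j k l = relRHS m (tSer m) i j k l := by
  have h : PowerSeries.map (PowerSeries.map (proj m : FreeT m →+* XOsp m))
      (relLHS m (freeT m) i j k l) = PowerSeries.map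
      (PowerSeries.map (proj m : FreeT m →+* XOsp m)) (relRHS m (freeT m) i j k l) := by
    ext r s
    simp only [coeff_map]
    exact RingQuot.mkAlgHom_rel ℂ (Rel.mk i j k l r s)
  rw [relLHS_map, relRHS_map] at h
  exact h

theorem map_preParity_freeT (i j : Fin (2 * m + 1)) :
    PowerSeries.map (preParity m : FreeT m →+* XOsp m) (freeT m i j) =
      ((-1 : ℤ) ^ (bar m i + bar m j)) • tSer m i j := by
  ext r
  rw [← coeff_zsmul', coeff_map, tSer, coeff_map]
  rcases r with _ | r
  · by_cases h : i = j
    · subst h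
      simp [freeT, ← two_mul, pow_mul]
    · simp [freeT, h]
  · simp [freeT, preParity]

theorem preParity_rel ⦃a b : FreeT m⦄ (h : Rel m a b) : preParity m a = preParity m b := by
  obtain ⟨i, j, k, l, r, s⟩ := h
  have h : PowerSeries.map (PowerSeries.map (preParity m : FreeT m →+* XOsp m))
      (relLHS m (freeT m) i j k l) = PowerSeries.map
      (PowerSeries.map (preParity m : FreeT m →+* XOsp m)) (relRHS m (freeT m) i j k l) := by
    rw [relLHS_map, relRHS_map]
    simp only [map_preParity_freeT]
    rw [relLHS_twist, relRHS_twist, relLHS_tSer]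
  have h2 := congrArg (fun f => coeff s (coeff r f)) h
  simp only [coeff_map] at h2
  exact h2

/-- The parity automorphism of `X(osp_{1|2m})`. -/
def parity : XOsp m →ₐ[ℂ] XOsp m :=
  RingQuot.liftAlgHom ℂ ⟨preParity m, preParity_rel m⟩

theorem parity_coeff_tSer (i j : Fin (2 * m + 1)) (r : ℕ) :
    parity m (coeff r (tSer m i j)) =
      ((-1 : ℤ) ^ (bar m i + bar m j)) • coeff r (tSer m i j) := by
  have h := congrArg (coeff r) (map_preParity_freeT m i j)
  rw [← coeff_zsmul', coeff_map] at h
  rw [← h, tSer, coeff_map]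
  exact RingQuot.liftAlgHom_mkAlgHom_apply ..

variable {m}

/-- The component of parity `0` of an element. -/
def evenPart (a : XOsp m) : XOsp m := (1 / 2 : ℂ) • (a + parity m a)

/-- The component of parity `1` of an element. -/
def oddPart (a : XOsp m) : XOsp m := (1 / 2 : ℂ) • (a - parity m a)

/-- The super-commutator, i.e. the bilinear extension of
`[a, b] = a b - b a (-1)^{p(a) p(b)}` for homogeneous `a`, `b`. -/
def sbr (a b : XOsp m) : XOsp m := a * b - (b * evenPart a + parity m b * oddPart a)

theorem sbr_of_homogeneous (p q : ℕ) (a b : XOsp m)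
    (ha : parity m a = ((-1 : ℤ) ^ p) • a) (hb : parity m b = ((-1 : ℤ) ^ q) • b) :
    sbr a b = a * b - ((-1 : ℤ) ^ (p * q)) • (b * a) := by
  have h2 : (2⁻¹ : ℂ) • a + (2⁻¹ : ℂ) • a = a := by
    rw [← add_smul]
    norm_num
  rw [sbr, evenPart, oddPart, ha, hb]
  congr 1
  rcases Nat.even_or_odd p with hp | hp
  · simp [hp.neg_one_pow, (hp.mul_right q).neg_one_pow, h2]
  · simp [hp.neg_one_pow, pow_mul, h2, mul_assoc]

/-- `[a, g(v)]`, taken coefficientwise. -/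
def sbrElt (a : XOsp m) (g : (XOsp m)⟦X⟧) : (XOsp m)⟦X⟧ :=
  PowerSeries.mk fun s => sbr a (coeff s g)

/-- `[f(u), g(v)]`, taken coefficientwise. -/
def sbrSer (f g : (XOsp m)⟦X⟧) : (XOsp m)⟦X⟧⟦X⟧ :=
  PowerSeries.mk fun r => sbrElt (coeff r f) g

end Grading

/-! ### The Gauss decomposition -/

section Gauss

variable {A : Type*} [Ring A] {n : ℕ}

/-- `T = F H E` with `F` lower unitriangular, `H = diag(h)` and `E` upper unitriangular. -/
structure IsGauss (T F : Matrix (Fin n) (Fin n) A⟦X⟧) (h : Fin n → A⟦X⟧)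
    (E : Matrix (Fin n) (Fin n) A⟦X⟧) : Prop where
  eq : T = F * Matrix.diagonal h * E
  F_diag : ∀ i, F i i = 1
  F_upper : ∀ i j, i < j → F i j = 0
  E_diag : ∀ i, E i i = 1
  E_lower : ∀ i j, j < i → E i j = 0

/-- The inverse of a series with constant term `1`. -/
def inv1 (g : A⟦X⟧) : A⟦X⟧ := invOfUnit g 1

/-- Gaussian elimination: after `k` steps, the entry `(i, j)` with `i, j ≥ k` (counting from `0`)
is the quasideterminant of the submatrix with rows `0, …, k-1, i` and columns `0, …, k-1, j`,
with respect to its last entry. -/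
def schur (T : Matrix (Fin n) (Fin n) A⟦X⟧) : ℕ → Matrix (Fin n) (Fin n) A⟦X⟧
  | 0 => T
  | k + 1 => Matrix.of fun i j =>
      if hk : k < n then
        schur T k i j - schur T k i ⟨k, hk⟩ * inv1 (schur T k ⟨k, hk⟩ ⟨k, hk⟩) * schur T k ⟨k, hk⟩ j
      else schur T k i j

/-- The series `h_i(u)`. -/
def gaussH (T : Matrix (Fin n) (Fin n) A⟦X⟧) (i : Fin n) : A⟦X⟧ := schur T i i i

/-- The series `e_ij(u)`, `i < j`, as the matrix `E(u)`. -/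
def gaussE (T : Matrix (Fin n) (Fin n) A⟦X⟧) : Matrix (Fin n) (Fin n) A⟦X⟧ :=
  Matrix.of fun i j =>
    if i = j then 1 else if i < j then inv1 (gaussH T i) * schur T i i j else 0

/-- The series `f_ji(u)`, `i < j`, as the matrix `F(u)`. -/
def gaussF (T : Matrix (Fin n) (Fin n) A⟦X⟧) : Matrix (Fin n) (Fin n) A⟦X⟧ :=
  Matrix.of fun j i =>
    if i = j then 1 else if i < j then schur T i j i * inv1 (gaussH T i) else 0

theorem constantCoeff_schur (T : Matrix (Fin n) (Fin n) A⟦X⟧)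
    (hT : ∀ i j, constantCoeff (T i j) = if i = j then 1 else 0) (k : ℕ) (i j : Fin n) :
    constantCoeff (schur T k i j) = if i = j ∧ k ≤ i.val then 1 else 0 := by
  induction k generalizing i j with
  | zero => simp [schur, hT]
  | succ k ih =>
    by_cases hk : k < n
    · simp only [schur, Matrix.of_apply, dif_pos hk, map_sub, map_mul, ih]
      simp only [inv1, constantCoeff_invOfUnit]
      by_cases h : i = j
      · subst h
        by_cases h2 : i = ⟨k, hk⟩
        · subst h2
          simp
        · have h3 : i.val ≠ k := fun h => h2 (Fin.ext h)
          by_cases h4 : k ≤ i.val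
          · simp [h2, h4, show k + 1 ≤ i.val by omega]
          · simp [h2, h4, show ¬ k + 1 ≤ i.val by omega]
      · by_cases h2 : i = ⟨k, hk⟩
        · have h3 : (⟨k, hk⟩ : Fin n) ≠ j := fun h' => h (h2.trans h')
          simp [h, h3]
        · simp [h, h2]
    · have h3 : ¬ k ≤ i.val := by omega
      have h4 : ¬ k + 1 ≤ i.val := by omega
      simp [schur, hk, ih, h3, h4]

theorem constantCoeff_gaussH (T : Matrix (Fin n) (Fin n) A⟦X⟧)
    (hT : ∀ i j, constantCoeff (T i j) = if i = j then 1 else 0) (i : Fin n) :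
    constantCoeff (gaussH T i) = 1 := by
  simp [gaussH, constantCoeff_schur T hT]

theorem mul_inv1 (g : A⟦X⟧) (h : constantCoeff g = 1) : g * inv1 g = 1 :=
  mul_invOfUnit g 1 (by simpa using h)

theorem inv1_mul (g : A⟦X⟧) (h : constantCoeff g = 1) : inv1 g * g = 1 :=
  invOfUnit_mul g 1 (by simpa using h)

theorem schur_succ (T : Matrix (Fin n) (Fin n) A⟦X⟧) (k i j : Fin n) :
    schur T (k.val + 1) i j =
      schur T k i j - schur T k i k * inv1 (schur T k k k) * schur T k k j := by
  simp [schur]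

theorem schur_eq_zero (T : Matrix (Fin n) (Fin n) A⟦X⟧)
    (hT : ∀ i j, constantCoeff (T i j) = if i = j then 1 else 0) (k : ℕ) (i j : Fin n)
    (h : i.val < k ∨ j.val < k) : schur T k i j = 0 := by
  induction k generalizing i j with
  | zero => omega
  | succ k ih =>
    by_cases hk : k < n
    · rw [schur_succ T ⟨k, hk⟩ i j]
      have hc : constantCoeff (schur T k ⟨k, hk⟩ ⟨k, hk⟩) = 1 := constantCoeff_gaussH T hT ⟨k, hk⟩
      by_cases h1 : i.val < k ∨ j.val < k
      · rw [ih i j h1]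
        rcases h1 with h1 | h1
        · rw [ih i ⟨k, hk⟩ (Or.inl h1)]
          simp
        · rw [ih ⟨k, hk⟩ j (Or.inr h1)]
          simp
      · rcases (show i.val = k ∨ j.val = k by omega) with h2 | h2
        · obtain rfl : i = ⟨k, hk⟩ := Fin.ext h2
          rw [mul_inv1 _ hc, one_mul, sub_self]
        · obtain rfl : j = ⟨k, hk⟩ := Fin.ext h2
          rw [mul_assoc, inv1_mul _ hc, mul_one, sub_self]
    · simp only [schur, Matrix.of_apply, dif_neg hk]
      exact ih i j (by omega)

theorem gaussE_lower (T : Matrix (Fin n) (Fin n) A⟦X⟧) {i j : Fin n} (h : j < i) :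
    gaussE T i j = 0 := by
  simp [gaussE, h.ne', h.not_gt]

theorem gaussF_upper (T : Matrix (Fin n) (Fin n) A⟦X⟧) {i j : Fin n} (h : i < j) :
    gaussF T i j = 0 := by
  simp [gaussF, h.ne', h.not_gt]

theorem gaussH_mul_gaussE (T : Matrix (Fin n) (Fin n) A⟦X⟧)
    (hT : ∀ i j, constantCoeff (T i j) = if i = j then 1 else 0) (k j : Fin n) :
    gaussH T k * gaussE T k j = schur T k k j := by
  rcases lt_trichotomy k j with h | h | h
  · simp only [gaussE, Matrix.of_apply, if_neg h.ne, if_pos h]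
    rw [← mul_assoc, mul_inv1 _ (constantCoeff_gaussH T hT k), one_mul]
  · subst h
    simp [gaussE, gaussH]
  · rw [gaussE_lower T h, schur_eq_zero T hT k k j (Or.inr h), mul_zero]

theorem gaussF_mul_gaussH (T : Matrix (Fin n) (Fin n) A⟦X⟧)
    (hT : ∀ i j, constantCoeff (T i j) = if i = j then 1 else 0) (k i : Fin n) :
    gaussF T i k * gaussH T k = schur T k i k := by
  rcases lt_trichotomy k i with h | h | h
  · simp only [gaussF, Matrix.of_apply, if_neg h.ne, if_pos h]
    rw [mul_assoc, inv1_mul _ (constantCoeff_gaussH T hT k), mul_one]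
  · subst h
    simp [gaussF, gaussH]
  · rw [gaussF_upper T h, schur_eq_zero T hT k i k (Or.inl h), zero_mul]

theorem isGauss_apply {T F E : Matrix (Fin n) (Fin n) A⟦X⟧} {h : Fin n → A⟦X⟧}
    (hG : T = F * Matrix.diagonal h * E) (i j : Fin n) :
    T i j = ∑ k, F i k * h k * E k j := by
  rw [hG, Matrix.mul_apply]
  simp only [Matrix.mul_diagonal]

/-- Existence of the Gauss decomposition of a matrix with constant term `1`. -/
theorem isGauss_gauss (T : Matrix (Fin n) (Fin n) A⟦X⟧)
    (hT : ∀ i j, constantCoeff (T i j) = if i = j then 1 else 0) :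
    IsGauss T (gaussF T) (gaussH T) (gaussE T) := by
  refine ⟨?_, fun i => by simp [gaussF], fun i j h => gaussF_upper T h,
    fun i => by simp [gaussE], fun i j h => gaussE_lower T h⟩
  ext1 i j
  rw [Matrix.mul_apply]
  simp only [Matrix.mul_diagonal]
  have hstep : ∀ k : Fin n, gaussF T i k * gaussH T k * gaussE T k j =
      schur T k i j - schur T (k.val + 1) i j := by
    intro k
    have hc := inv1_mul _ (constantCoeff_gaussH T hT k)
    rw [schur_succ, sub_sub_cancel, show schur T k k k = gaussH T k from rfl,
      ← gaussF_mul_gaussH T hT, ← gaussH_mul_gaussE T hT, mul_assoc (gaussF T i k * gaussH T k),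
      ← mul_assoc (inv1 _), hc, one_mul]
  rw [Finset.sum_congr rfl fun k _ => hstep k,
    Fin.sum_univ_eq_sum_range (fun k => schur T k i j - schur T (k + 1) i j) n,
    Finset.sum_range_sub', schur_eq_zero T hT n i j (Or.inl i.isLt), sub_zero]
  rfl

/-- Uniqueness of the Gauss decomposition of a matrix with constant term `1`. -/
theorem IsGauss.unique {T F E : Matrix (Fin n) (Fin n) A⟦X⟧} {h : Fin n → A⟦X⟧}
    (hT : ∀ i j, constantCoeff (T i j) = if i = j then 1 else 0) (hG : IsGauss T F h E) :
    F = gaussF T ∧ h = gaussH T ∧ E = gaussE T := by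
  have row : ∀ (k j : Fin n), (∑ p, if k ≤ p then F k p * h p * E p j else 0) = h k * E k j := by
    intro k j
    rw [Finset.sum_eq_single k]
    · simp [hG.F_diag]
    · intro p _ hp
      split_ifs with hkp
      · rw [hG.F_upper k p (lt_of_le_of_ne hkp hp.symm)]
        simp
      · rfl
    · simp
  have col : ∀ (k i : Fin n), (∑ p, if k ≤ p then F i p * h p * E p k else 0) = F i k * h k := by
    intro k i
    rw [Finset.sum_eq_single k]
    · simp [hG.E_diag]
    · intro p _ hp
      split_ifs with hkp
      · rw [hG.E_lower p k (lt_of_le_of_ne hkp hp.symm)]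
        simp
      · rfl
    · simp
  have main : ∀ k : ℕ, ∀ i j : Fin n,
      schur T k i j = ∑ p : Fin n, if k ≤ p.val then F i p * h p * E p j else 0 := by
    intro k
    induction k with
    | zero =>
      intro i j
      simp only [schur, Nat.zero_le, if_true]
      exact isGauss_apply hG.eq i j
    | succ k ih =>
      intro i j
      by_cases hk : k < n
      · have e1 : ∀ j, schur T k ⟨k, hk⟩ j = h ⟨k, hk⟩ * E ⟨k, hk⟩ j := fun j =>
          (ih _ _).trans (row ⟨k, hk⟩ j)
        have e2 : schur T k i ⟨k, hk⟩ = F i ⟨k, hk⟩ * h ⟨k, hk⟩ := (ih _ _).trans (col ⟨k, hk⟩ i)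
        have e3 : schur T k ⟨k, hk⟩ ⟨k, hk⟩ = h ⟨k, hk⟩ := by rw [e1, hG.E_diag, mul_one]
        have hc : constantCoeff (h ⟨k, hk⟩) = 1 := by
          rw [← e3]
          exact constantCoeff_gaussH T hT ⟨k, hk⟩
        have e4 := schur_succ T ⟨k, hk⟩ i j
        simp only at e4
        rw [e4, e3, e2, e1 j, mul_assoc (F i ⟨k, hk⟩), mul_inv1 _ hc, mul_one, ← mul_assoc, ih,
          sub_eq_iff_eq_add]
        have e5 : ∀ p : Fin n, (if k ≤ p.val then F i p * h p * E p j else 0) =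
            (if k + 1 ≤ p.val then F i p * h p * E p j else 0) +
              (if p = ⟨k, hk⟩ then F i p * h p * E p j else 0) := by
          intro p
          by_cases hp : p = ⟨k, hk⟩
          · subst hp
            simp
          · have : p.val ≠ k := fun h => hp (Fin.ext h)
            by_cases h6 : k ≤ p.val
            · simp [hp, h6, show k + 1 ≤ p.val by omega]
            · simp [hp, h6, show ¬ k + 1 ≤ p.val by omega]
        rw [Finset.sum_congr rfl fun p _ => e5 p, Finset.sum_add_distrib]
        simp
      · simp only [schur, Matrix.of_apply, dif_neg hk]
        rw [ih]
        refine Finset.sum_congr rfl fun p _ => ?_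
        rw [if_neg (by omega), if_neg (by omega)]
  have hrow : ∀ k j : Fin n, schur T k k j = h k * E k j := fun k j => (main _ _ _).trans (row k j)
  have hcol : ∀ k i : Fin n, schur T k i k = F i k * h k := fun k i => (main _ _ _).trans (col k i)
  have hh : ∀ k, h k = gaussH T k := fun k => by rw [gaussH, hrow, hG.E_diag, mul_one]
  refine ⟨?_, funext hh, ?_⟩
  · ext1 i k
    have h1 := (gaussF_mul_gaussH T hT k i).trans (hcol k i)
    rw [hh k] at h1
    have h2 := congrArg (· * inv1 (gaussH T k)) h1
    simp only [mul_assoc, mul_inv1 _ (constantCoeff_gaussH T hT k), mul_one] at h2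
    exact h2.symm
  · ext1 k j
    have h1 := (gaussH_mul_gaussE T hT k j).trans (hrow k j)
    rw [hh k] at h1
    have h2 := congrArg (inv1 (gaussH T k) * ·) h1
    simp only [← mul_assoc, inv1_mul _ (constantCoeff_gaussH T hT k), one_mul] at h2
    exact h2.symm

end Gauss

/-- The series `e_ij(u)` over `X(osp_{1|2m})`; the indices are counted from `0`. -/
def eSer (m : ℕ) (i j : Fin (2 * m + 1)) : (XOsp m)⟦X⟧ := gaussE (tMat m) i j

theorem constantCoeff_tMat (m : ℕ) (i j : Fin (2 * m + 1)) :
    constantCoeff (tMat m i j) = if i = j then 1 else 0 := by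
  rw [← coeff_zero_eq_constantCoeff_apply, tMat, Matrix.of_apply, tSer, coeff_map]
  by_cases h : i = j <;> simp [freeT, h]

end OspYangian

end

open OspYangian

/-!
Write `T(u) = F(u) H(u) E(u)`. The defining relations between the first `m` rows of `T` give closed
relations between the first row of `T(u)` and the first Schur complement `S(v)` of `T(v)`.
The series `t₁₁(u)` commutes with the entries of `S` in those rows, except in the last column, where
the commutator is `-t₁₁(u) D` and `D` satisfies `(u - v - κ) D = P + D` with `P` a combination of
the `e₁ₚ(u)`. Hence `(u - v - κ - 1) D = P`, and as no nonzero series in `v⁻¹` alone is divisible by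
`u - v - c`, this forces `D` to be the divided difference of `P` at `u = v + κ + 1`.
Dividing by the invertible series `t₁₁(u)` and `h₂(v)` turns the relations into relations for `E`.
-/

namespace OspYangian

section Series

variable {A : Type*} [Ring A]

theorem commute_C_X (f : A⟦X⟧⟦X⟧) : Commute (C X) f := by
  ext1 r
  rw [coeff_C_mul, coeff_mul_C, (commute_X _).eq]

theorem commute_monUV (f : A⟦X⟧⟦X⟧) : Commute (monUV A) f :=
  (commute_X f).symm.mul_left (commute_C_X f)

theorem atU_mul (f g : A⟦X⟧) : atU (f * g) = atU f * atU g := map_mul _ _ _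

theorem atV_mul (f g : A⟦X⟧) : atV (f * g) = atV f * atV g := map_mul _ _ _

theorem atV_sub (f g : A⟦X⟧) : atV (f - g) = atV f - atV g := map_sub _ _ _

theorem atU_one : atU (1 : A⟦X⟧) = 1 := map_one _

theorem atV_one : atV (1 : A⟦X⟧) = 1 := map_one _

theorem atV_zero : atV (0 : A⟦X⟧) = 0 := map_zero _

theorem atV_sum {ι : Type*} (s : Finset ι) (f : ι → A⟦X⟧) :
    atV (∑ p ∈ s, f p) = ∑ p ∈ s, atV (f p) := map_sum _ _ _

theorem isUnit_atU {g : A⟦X⟧} (hg : constantCoeff g = 1) : IsUnit (atU g) :=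
  (isUnit_iff_constantCoeff.mpr (hg ▸ isUnit_one)).map (PowerSeries.map C)

theorem isUnit_atV {g : A⟦X⟧} (hg : constantCoeff g = 1) : IsUnit (atV g) :=
  (isUnit_iff_constantCoeff.mpr (hg ▸ isUnit_one)).map C

variable [Algebra ℂ A] {c : ℂ}

theorem commute_linUV (c : ℂ) (f : A⟦X⟧⟦X⟧) : Commute (linUV A c) f :=
  ((commute_C_X f).sub_left (commute_X f).symm).sub_left ((commute_monUV f).smul_left c)

theorem linUV_sub_monUV (c : ℂ) : linUV A c - monUV A = linUV A (c + 1) := by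
  rw [linUV, linUV, add_smul, one_smul, sub_sub]

theorem coeff_zero_linUV_mul (c : ℂ) (f : A⟦X⟧⟦X⟧) :
    coeff 0 (linUV A c * f) = X * coeff 0 f := by
  simp only [linUV, monUV, sub_mul, ← mul_smul_comm, mul_assoc, map_sub, coeff_C_mul,
    coeff_zero_X_mul, sub_zero]

theorem coeff_succ_linUV_mul (c : ℂ) (f : A⟦X⟧⟦X⟧) (r : ℕ) :
    coeff (r + 1) (linUV A c * f) = X * coeff (r + 1) f - (1 + c • X) * coeff r f := by
  have coeff_smul_C_X_mul : coeff r (c • (C X * f)) = c • (X * coeff r f) := by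
    rw [← coeff_C_mul]
    rfl
  simp only [linUV, monUV, sub_mul, smul_mul_assoc, mul_assoc, map_sub, coeff_C_mul]
  rw [← mul_smul_comm, coeff_succ_X_mul, coeff_succ_X_mul, coeff_smul_C_X_mul, add_mul, one_mul,
    smul_mul_assoc, sub_sub]

theorem isLeftRegular_linUV (c : ℂ) : IsLeftRegular (linUV A c) := by
  refine isLeftRegular_iff_right_eq_zero_of_mul.mpr fun f hf => ?_
  ext1 r
  rw [map_zero]
  refine X_mul_cancel ?_
  induction r with
  | zero => rw [← coeff_zero_linUV_mul c, hf, map_zero, mul_zero]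
  | succ r ih =>
    have h := coeff_succ_linUV_mul c f r
    rw [hf, X_mul_cancel ih, mul_zero, sub_zero, map_zero] at h
    rw [← h, mul_zero]

theorem eq_zero_of_mul_eq_X_mul_succ {f : ℕ → A⟦X⟧}
    (hf : ∀ r, (1 + c • X) * f r = X * f (r + 1)) (r : ℕ) : f r = 0 := by
  -- `1 + c • X` is a unit, so every `f r` is divisible by arbitrarily high powers of `X`.
  have coeff_eq_zero : ∀ n r, coeff n (f r) = 0 := by
    intro n
    induction n with
    | zero => intro r; simpa [add_mul] using congrArg (coeff 0) (hf r)
    | succ n ih =>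
      intro r
      simpa [add_mul, coeff_succ_X_mul, ih] using congrArg (coeff (n + 1)) (hf r)
  ext n
  exact coeff_eq_zero n r

theorem eq_zero_of_linUV_mul_eq {f : A⟦X⟧⟦X⟧} {g : A⟦X⟧}
    (h : linUV A c * f = monUV A * atV g) : g = 0 := by
  have rhs_eq : monUV A * atV g = X * C (X * g) := by rw [monUV, mul_assoc, atV, map_mul]
  rw [rhs_eq] at h
  have coeff_zero : coeff 0 f = 0 := by
    refine X_mul_cancel ?_
    rw [← coeff_zero_linUV_mul c, h, coeff_zero_X_mul, mul_zero]
  have coeff_one : coeff 1 f = g := by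
    have h₁ := coeff_succ_linUV_mul c f 0
    rw [h, coeff_zero, mul_zero, sub_zero, coeff_succ_X_mul, coeff_zero_C] at h₁
    exact (X_mul_cancel h₁).symm
  have coeff_succ (r : ℕ) : (1 + c • X) * coeff (r + 1) f = X * coeff (r + 1 + 1) f := by
    have h₂ := coeff_succ_linUV_mul c f (r + 1)
    rw [h, coeff_succ_X_mul, coeff_C, if_neg r.succ_ne_zero] at h₂
    exact (sub_eq_zero.mp h₂.symm).symm
  rw [← coeff_one]
  exact eq_zero_of_mul_eq_X_mul_succ (f := fun r => coeff (r + 1) f) coeff_succ 0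

theorem eq_sum_mul_divDiff {ι : Type*} {s : Finset ι} {a g : ι → A⟦X⟧} {f : A⟦X⟧⟦X⟧}
    (h : linUV A c * f = monUV A * ∑ p ∈ s, atV (a p) * atU (g p)) :
    f = ∑ p ∈ s, atV (a p) * divDiff c (g p) := by
  have linUV_mul_term (p : ι) : linUV A c * (atV (a p) * divDiff c (g p)) =
      monUV A * (atV (a p) * atU (g p)) - monUV A * atV (a p * shift c (g p)) := by
    rw [(commute_linUV c _).left_comm, linUV_mul_divDiff, (commute_monUV _).symm.left_comm,
      mul_sub, mul_sub, atV_mul]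
  have linUV_mul_sub : linUV A c * (f - ∑ p ∈ s, atV (a p) * divDiff c (g p)) =
      monUV A * atV (∑ p ∈ s, a p * shift c (g p)) := by
    rw [atV_sum]
    simp only [mul_sub, h, Finset.mul_sum, linUV_mul_term, Finset.sum_sub_distrib, sub_sub_cancel]
  have remainder_eq_zero := eq_zero_of_linUV_mul_eq linUV_mul_sub
  rw [remainder_eq_zero, atV, map_zero, mul_zero] at linUV_mul_sub
  exact sub_eq_zero.mp (isLeftRegular_iff_right_eq_zero_of_mul.mp (isLeftRegular_linUV c) _
    linUV_mul_sub)

theorem shift_zero_left (g : A⟦X⟧) : shift 0 g = g := by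
  ext n
  have shiftVar_zero : shiftVar 0 = X := by simp [shiftVar]
  simp [shift, shiftVar_zero, coeff_X_pow]

theorem divDiff_one (c : ℂ) : divDiff c (1 : A⟦X⟧) = 0 := by
  have divDiff₀_one : divDiff₀ (1 : A⟦X⟧) = 0 := by
    ext r s
    simp only [divDiff₀, coeff_mk, coeff_one, map_zero]
    split_ifs <;> first | rfl | omega | exact neg_zero
  ext1 r
  rw [divDiff, coeff_mk, divDiff₀_one, map_zero, shift_zero]

theorem coeff_one_divDiff (c : ℂ) {g : A⟦X⟧} (hg : constantCoeff g = 0) :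
    coeff 1 (divDiff c g) = -shift c g := by
  have coeff_one_divDiff₀ : coeff 1 (divDiff₀ g) = -g := by
    ext s
    cases s <;> simp [divDiff₀, hg]
  rw [divDiff, coeff_mk, coeff_one_divDiff₀, eq_neg_iff_add_eq_zero, ← shift_add, neg_add_cancel,
    shift_zero]

theorem coeff_one_atV_mul_divDiff (c : ℂ) (f : A⟦X⟧) {g : A⟦X⟧} (hg : constantCoeff g = 0) :
    coeff 1 (atV f * divDiff c g) = -(f * shift c g) := by
  rw [atV, coeff_C_mul, coeff_one_divDiff c hg, mul_neg]

end Series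

theorem lie_schur_complement {R : Type*} [Ring R] {L K M : R} (hL : ∀ z, Commute L z)
    (hK : ∀ z, Commute K z) (hM : ∀ z, Commute M z) {x y X Y a A t Q α ε G₁ G₂ : R}
    (hA : L * ⁅x, A⁆ = -(M * (x * A - X * a)))
    (hαA : L * ⁅x, α * A⁆ = -(M * (y * A - Y * a)))
    (hAε : L * K * ⁅x, A * ε⁆ = -(M * K * (x * (A * ε) - X * t)) - M * L * G₁)
    (hQ : L * K * ⁅x, Q⁆ = -(M * K * (y * (A * ε) - Y * t)) - M * L * G₂) :
    L * K * ⁅x, Q - α * (A * ε)⁆ =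
      M * K * ((Y - α * X) * (t - a * ε)) - M * L * (G₂ - α * G₁) := by
  have leibniz : ⁅x, Q - α * (A * ε)⁆ =
      ⁅x, Q⁆ - (⁅x, α * A⁆ - α * ⁅x, A⁆) * ε - α * ⁅x, A * ε⁆ := by
    simp only [Ring.lie_def]
    noncomm_ring
  have lie_α : L * (⁅x, α * A⁆ - α * ⁅x, A⁆) = -(M * ((y - α * x) * A - (Y - α * X) * a)) := by
    rw [mul_sub, hαA, (hL α).left_comm, hA, mul_neg, ← (hM α).left_comm]
    noncomm_ring
  have hLK : L * K = K * L := hL K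
  have hMK : M * K = K * M := hM K
  calc L * K * ⁅x, Q - α * (A * ε)⁆
    _ = L * K * ⁅x, Q⁆ - K * (L * (⁅x, α * A⁆ - α * ⁅x, A⁆)) * ε - α * (L * K * ⁅x, A * ε⁆) := by
      rw [leibniz, mul_sub, mul_sub, ((hL α).mul_left (hK α)).left_comm, hLK]
      noncomm_ring
    _ = M * K * ((Y - α * X) * (t - a * ε)) - M * L * (G₂ - α * G₁) := by
      rw [hQ, lie_α, hAε, mul_sub α, mul_neg α, ← ((hM α).mul_left (hK α)).left_comm,
        ← ((hM α).mul_left (hL α)).left_comm, hMK]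
      noncomm_ring

section FirstSchurComplement

variable {A : Type*} [Ring A] {n : ℕ} {T : Matrix (Fin (n + 1)) (Fin (n + 1)) A⟦X⟧}

theorem mul_gaussE_zero (hT : ∀ i j, constantCoeff (T i j) = if i = j then 1 else 0)
    (l : Fin (n + 1)) : T 0 0 * gaussE T 0 l = T 0 l :=
  gaussH_mul_gaussE T hT 0 l

theorem gaussF_zero_mul (hT : ∀ i j, constantCoeff (T i j) = if i = j then 1 else 0)
    (k : Fin (n + 1)) : gaussF T k 0 * T 0 0 = T k 0 :=
  gaussF_mul_gaussH T hT 0 k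

theorem schur_one (hT : ∀ i j, constantCoeff (T i j) = if i = j then 1 else 0)
    (i j : Fin (n + 1)) : schur T 1 i j = T i j - gaussF T i 0 * T 0 j := by
  calc schur T 1 i j = T i j - T i 0 * inv1 (T 0 0) * T 0 j := schur_succ T 0 i j
    _ = T i j - gaussF T i 0 * T 0 j := by
      rw [← gaussF_zero_mul hT i, mul_assoc (gaussF T i 0),
        mul_inv1 _ ((hT 0 0).trans (if_pos rfl)), mul_one]

theorem gaussE_diag (hT : ∀ i j, constantCoeff (T i j) = if i = j then 1 else 0)
    (i : Fin (n + 1)) : gaussE T i i = 1 :=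
  (isGauss_gauss T hT).E_diag i

theorem constantCoeff_gaussE_of_lt
    (hT : ∀ i j, constantCoeff (T i j) = if i = j then 1 else 0) {i j : Fin (n + 1)} (hij : i < j) :
    constantCoeff (gaussE T i j) = 0 := by
  have h := congrArg constantCoeff (gaussH_mul_gaussE T hT i j)
  rwa [map_mul, constantCoeff_gaussH T hT, one_mul, constantCoeff_schur T hT,
    if_neg fun h => hij.ne h.1] at h

end FirstSchurComplement

theorem val_one_eq {m : ℕ} (hm : 0 < m) : (1 : Fin (2 * m + 1)).val = 1 :=
  Nat.mod_eq_of_lt (show 1 < 2 * m + 1 by omega)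

theorem ne_rev_of_lt {m : ℕ} {i j : Fin (2 * m + 1)} (hi : i.val < m) (hj : j.val < m) :
    i ≠ j.rev := fun h => by
  rw [h, Fin.val_rev] at hi
  omega

section RowPairing

variable {A : Type*} [Ring A] {m : ℕ}

/-- The pairing `∑ₚ θₚ f_{p'}(v) gₚ` of two rows which occurs in the defining relations; `g` is
allowed to depend on both `u` and `v`. -/
noncomputable def rowPairing (f : Fin (2 * m + 1) → A⟦X⟧) (g : Fin (2 * m + 1) → A⟦X⟧⟦X⟧) :
    A⟦X⟧⟦X⟧ :=
  ∑ p, theta m p • (atV (f p.rev) * g p)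

theorem rowPairing_sub_mul_left (a : A⟦X⟧) (f₁ f₂ : Fin (2 * m + 1) → A⟦X⟧)
    (g : Fin (2 * m + 1) → A⟦X⟧⟦X⟧) :
    rowPairing (fun p => f₁ p - a * f₂ p) g = rowPairing f₁ g - atV a * rowPairing f₂ g := by
  simp only [rowPairing, atV_sub, atV_mul, sub_mul, smul_sub, Finset.sum_sub_distrib,
    Finset.mul_sum, mul_smul_comm, mul_assoc]

theorem rowPairing_mul_left (a : A⟦X⟧) (f : Fin (2 * m + 1) → A⟦X⟧)
    (g : Fin (2 * m + 1) → A⟦X⟧⟦X⟧) :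
    rowPairing (fun p => a * f p) g = atV a * rowPairing f g := by
  simp only [rowPairing, atV_mul, Finset.mul_sum, mul_smul_comm, mul_assoc]

theorem neg_one_pow_bar_mul_theta_rev (p : Fin (2 * m + 1)) :
    (-1 : ℤ) ^ bar m p * theta m p.rev = theta m p := by
  have hp := p.isLt
  rcases lt_trichotomy p.val m with h | h | h
  · simp [bar, theta, h.ne, h.le, show ¬ 2 * m - p.val ≤ m by omega]
  · simp [bar, theta, h, show 2 * m - m = m by omega]
  · simp [bar, theta, h.ne', h.not_ge, show 2 * m - p.val ≤ m by omega]

theorem rowPairing_divDiff_gaussE_zero [Algebra ℂ A]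
    {T : Matrix (Fin (2 * m + 1)) (Fin (2 * m + 1)) A⟦X⟧}
    (hT : ∀ i j, constantCoeff (T i j) = if i = j then 1 else 0)
    (f : Fin (2 * m + 1) → A⟦X⟧) (c : ℂ) :
    rowPairing f (fun p => divDiff c (gaussE T 0 p)) =
      ∑ p ∈ Finset.Ioi 0, theta m p • (atV (f p.rev) * divDiff c (gaussE T 0 p)) := by
  refine (Finset.sum_subset (Finset.subset_univ _) fun p _ hp => ?_).symm
  obtain rfl : p = 0 := by simpa using hp
  beta_reduce
  rw [gaussE_diag hT, divDiff_one, mul_zero, smul_zero]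

end RowPairing

section GeneratorMatrix

variable {A : Type*} [Ring A] [Algebra ℂ A] {m : ℕ}

variable (m) in
/-- `T(u)` is a generator matrix over `A`: it has constant term `1` and satisfies the defining
relations of `X(osp_{1|2m})`. These are the matrices arising from algebra homomorphisms
`X(osp_{1|2m}) → A`. -/
structure IsGeneratorMatrix (T : Matrix (Fin (2 * m + 1)) (Fin (2 * m + 1)) A⟦X⟧) : Prop where
  constantCoeff_eq : ∀ i j, constantCoeff (T i j) = if i = j then 1 else 0
  relLHS_eq_relRHS : ∀ i j k l, relLHS m T i j k l = relRHS m T i j k l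

theorem isGeneratorMatrix_tMat (m : ℕ) : IsGeneratorMatrix m (tMat m) :=
  ⟨constantCoeff_tMat m, relLHS_tSer m⟩

namespace IsGeneratorMatrix

variable {T : Matrix (Fin (2 * m + 1)) (Fin (2 * m + 1)) A⟦X⟧} {i j k l : Fin (2 * m + 1)}

theorem linUV_mul_lie_apply (hT : IsGeneratorMatrix m T) (hi : i.val < m) (hj : j.val < m)
    (hk : k.val < m) :
    linUV A 0 * linUV A (kappa m) * ⁅atU (T i j), atV (T k l)⁆ =
      -(monUV A * linUV A (kappa m) * (atU (T k j) * atV (T i l) - atV (T k j) * atU (T i l))) -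
        monUV A * linUV A 0 *
          (if l = j.rev then rowPairing (T k) (fun p => atU (T i p)) else 0) := by
  have bar_eq {a : Fin (2 * m + 1)} (ha : a.val < m) : bar m a = 1 := if_neg ha.ne
  have theta_rev_eq : theta m j.rev = -1 := if_neg (by rw [Fin.val_rev]; omega)
  have sign_lhs : (-1 : ℤ) ^ ((1 + 1) * (1 + bar m l)) = 1 := by rw [pow_mul]; norm_num
  have sign_swap : (-1 : ℤ) ^ (1 * 1 + 1 * 1 + 1 * 1) = -1 := by norm_num
  have sign_pairing (p : Fin (2 * m + 1)) :
      (-1 : ℤ) ^ (1 * 1 + 1 * 1 + 1 * bar m p) * -1 * theta m p.rev = -theta m p := by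
    rw [← neg_one_pow_bar_mul_theta_rev p]
    ring
  have h := hT.relLHS_eq_relRHS i j k l
  unfold relLHS relRHS at h
  rw [bar_eq hi, bar_eq hj, bar_eq hk, theta_rev_eq, if_neg (ne_rev_of_lt hk hi),
    sign_lhs, sign_swap] at h
  simp only [sign_pairing, one_smul, neg_smul, Finset.sum_neg_distrib] at h
  rw [Ring.lie_def, h, mul_neg, rowPairing]
  congr 2
  split_ifs
  · rw [zero_sub, neg_neg]
  · rw [sub_zero]

theorem linUV_zero_mul_lie_apply (hT : IsGeneratorMatrix m T) (hi : i.val < m) (hj : j.val < m)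
    (hk : k.val < m) (hl : l ≠ j.rev) :
    linUV A 0 * ⁅atU (T i j), atV (T k l)⁆ =
      -(monUV A * (atU (T k j) * atV (T i l) - atV (T k j) * atU (T i l))) := by
  refine isLeftRegular_linUV (kappa m) ?_
  have h := hT.linUV_mul_lie_apply hi hj hk (l := l)
  rw [if_neg hl, mul_zero, sub_zero, (commute_linUV _ _).eq, ← (commute_linUV (kappa m) _).eq] at h
  beta_reduce
  rw [← mul_assoc, mul_neg, ← mul_assoc]
  exact h

theorem linUV_mul_linUV_mul_lie_schur (hT : IsGeneratorMatrix m T) (hj : j.val < m)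
    (hk : k.val < m) :
    linUV A 0 * linUV A (kappa m) * ⁅atU (T 0 j), atV (schur T 1 k l)⁆ =
      monUV A * linUV A (kappa m) *
          (atV (schur T 1 k j) * (atU (T 0 l) - atU (T 0 0) * atV (gaussE T 0 l))) -
        monUV A * linUV A 0 *
          (if l = j.rev then rowPairing (schur T 1 k) (fun p => atU (T 0 p)) else 0) := by
  have hT₁ := hT.constantCoeff_eq
  have h0 : (0 : Fin (2 * m + 1)).val < m := j.val.zero_le.trans_lt hj
  have lie_apply_zero {k : Fin (2 * m + 1)} (hk : k.val < m) :=
    hT.linUV_zero_mul_lie_apply h0 hj hk (ne_rev_of_lt h0 hj)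
  have lie_apply {k : Fin (2 * m + 1)} (hk : k.val < m) :=
    hT.linUV_mul_lie_apply h0 hj hk (l := l)
  have schur_eq (p : Fin (2 * m + 1)) :
      atV (schur T 1 k p) = atV (T k p) - atV (gaussF T k 0) * atV (T 0 p) := by
    rw [schur_one hT₁, atV_sub, atV_mul]
  have pairing_eq : (if l = j.rev then rowPairing (schur T 1 k) (fun p => atU (T 0 p)) else 0) =
      (if l = j.rev then rowPairing (T k) (fun p => atU (T 0 p)) else 0) -
        atV (gaussF T k 0) *
          (if l = j.rev then rowPairing (T 0) (fun p => atU (T 0 p)) else 0) := by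
    rw [funext (schur_one hT₁ k), rowPairing_sub_mul_left, mul_ite, mul_zero]
    split_ifs
    · rfl
    · rw [sub_zero]
  have hαA := lie_apply_zero hk
  have hAε := lie_apply h0
  have hQ := lie_apply hk
  rw [← gaussF_zero_mul hT₁ k, atV_mul] at hαA
  rw [← mul_gaussE_zero hT₁ l, atV_mul] at hAε hQ
  rw [pairing_eq, schur_eq, schur_eq, ← mul_gaussE_zero hT₁ l, atV_mul (T 0 0)]
  exact lie_schur_complement (commute_linUV 0) (commute_linUV (kappa m)) commute_monUV
    (lie_apply_zero h0) hαA hAε hQ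

theorem monUV_mul_sub_eq (hT : IsGeneratorMatrix m T) (l : Fin (2 * m + 1)) :
    monUV A * (atU (T 0 l) - atU (T 0 0) * atV (gaussE T 0 l)) =
      linUV A 0 * (atU (T 0 0) * divDiff 0 (gaussE T 0 l)) := by
  rw [(commute_linUV 0 (atU (T 0 0))).left_comm, linUV_mul_divDiff, shift_zero_left,
    ← (commute_monUV (atU (T 0 0))).left_comm, mul_sub (atU (T 0 0)), ← atU_mul,
    mul_gaussE_zero hT.constantCoeff_eq]

theorem linUV_mul_lie_schur (hT : IsGeneratorMatrix m T) (hj : j.val < m) (hk : k.val < m) :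
    linUV A (kappa m) * ⁅atU (T 0 j), atV (schur T 1 k l)⁆ =
      linUV A (kappa m) * (atV (schur T 1 k j) * (atU (T 0 0) * divDiff 0 (gaussE T 0 l))) -
        monUV A *
          (if l = j.rev then rowPairing (schur T 1 k) (fun p => atU (T 0 p)) else 0) := by
  refine isLeftRegular_linUV 0 ?_
  beta_reduce
  rw [← mul_assoc, hT.linUV_mul_linUV_mul_lie_schur hj hk, mul_sub (linUV A 0),
    (commute_linUV 0 (linUV A (kappa m))).left_comm,
    (commute_linUV 0 (atV (schur T 1 k j))).left_comm,
    ← hT.monUV_mul_sub_eq, (commute_linUV 0 (monUV A)).left_comm,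
    ← (commute_monUV (atV (schur T 1 k j))).left_comm,
    ← (commute_monUV (linUV A (kappa m))).left_comm, mul_assoc, mul_assoc]

theorem linUV_mul_lie_zero_schur (hT : IsGeneratorMatrix m T) (hm : 0 < m) (hk : k.val < m) :
    linUV A (kappa m) * ⁅atU (T 0 0), atV (schur T 1 k l)⁆ =
      -(monUV A *
        (if l = Fin.rev 0 then rowPairing (schur T 1 k) (fun p => atU (T 0 p)) else 0)) := by
  have schur_zero : schur T 1 k 0 = 0 :=
    schur_eq_zero T hT.constantCoeff_eq 1 k 0 (Or.inr Nat.one_pos)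
  rw [hT.linUV_mul_lie_schur (j := 0) hm hk, schur_zero, atV_zero, zero_mul, mul_zero, zero_sub]

theorem commute_atU_schur (hT : IsGeneratorMatrix m T) (hm : 0 < m) (hk : k.val < m)
    (hl : l ≠ Fin.rev 0) : Commute (atU (T 0 0)) (atV (schur T 1 k l)) := by
  refine sub_eq_zero.mp (isLeftRegular_iff_right_eq_zero_of_mul.mp
    (isLeftRegular_linUV (kappa m)) _ ?_)
  rw [← Ring.lie_def, hT.linUV_mul_lie_zero_schur hm hk, if_neg hl, mul_zero, neg_zero]

theorem rowPairing_schur_apply_zero (hT : IsGeneratorMatrix m T) (hm : 0 < m) (hk : k.val < m) :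
    rowPairing (schur T 1 k) (fun p => atU (T 0 p)) =
      atU (T 0 0) * rowPairing (schur T 1 k) (fun p => atU (gaussE T 0 p)) -
        ⁅atU (T 0 0), atV (schur T 1 k (Fin.rev 0))⁆ := by
  have term_eq (p : Fin (2 * m + 1)) : atV (schur T 1 k p.rev) * atU (T 0 p) =
      atU (T 0 0) * (atV (schur T 1 k p.rev) * atU (gaussE T 0 p)) -
        if p = 0 then ⁅atU (T 0 0), atV (schur T 1 k (Fin.rev 0))⁆ else 0 := by
    rw [← mul_gaussE_zero hT.constantCoeff_eq p, atU_mul]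
    split_ifs with hp
    · rw [hp, gaussE_diag hT.constantCoeff_eq, atU_one, mul_one, mul_one, Ring.lie_def,
        sub_sub_cancel]
    · have h := hT.commute_atU_schur hm hk (Fin.rev_injective.ne hp)
      rw [sub_zero, h.left_comm]
  have theta_zero : theta m 0 = 1 := if_pos (Nat.zero_le m)
  simp only [rowPairing, term_eq, smul_sub, Finset.sum_sub_distrib, smul_ite, smul_zero,
    Finset.sum_ite_eq', Finset.mem_univ, if_true, theta_zero, one_smul, Finset.mul_sum,
    mul_smul_comm]

theorem lie_atU_schur_rev_zero (hT : IsGeneratorMatrix m T) (hm : 0 < m) (hk : k.val < m) :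
    ⁅atU (T 0 0), atV (schur T 1 k (Fin.rev 0))⁆ =
      -(atU (T 0 0) *
        rowPairing (schur T 1 k) (fun p => divDiff (kappa m + 1) (gaussE T 0 p))) := by
  have isUnit_T : IsUnit (atU (T 0 0)) :=
    isUnit_atU ((hT.constantCoeff_eq 0 0).trans (if_pos rfl))
  obtain ⟨D, hD⟩ := (IsUnit.isUnit_iff_mulLeft_bijective.mp isUnit_T).surjective
    (-⁅atU (T 0 0), atV (schur T 1 k (Fin.rev 0))⁆)
  have lie_eq : ⁅atU (T 0 0), atV (schur T 1 k (Fin.rev 0))⁆ = -(atU (T 0 0) * D) := by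
    rw [← neg_eq_iff_eq_neg]
    exact hD.symm
  have linUV_mul_D : linUV A (kappa m + 1) * D =
      monUV A * rowPairing (schur T 1 k) (fun p => atU (gaussE T 0 p)) := by
    refine isUnit_T.mul_left_cancel ?_
    have h := hT.linUV_mul_lie_zero_schur hm hk (l := Fin.rev 0)
    rw [if_pos rfl, hT.rowPairing_schur_apply_zero hm hk, lie_eq, mul_neg, neg_inj, sub_neg_eq_add,
      mul_add, ← sub_eq_iff_eq_add, ← sub_mul, linUV_sub_monUV] at h
    rw [← (commute_linUV _ (atU (T 0 0))).left_comm, h, (commute_monUV (atU (T 0 0))).left_comm]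
  simp only [rowPairing, ← smul_mul_assoc, ← atV_zsmul] at linUV_mul_D ⊢
  rw [lie_eq, eq_sum_mul_divDiff linUV_mul_D]

theorem lie_atU_gaussE_schur (hT : IsGeneratorMatrix m T) (hj : j.val < m) (hk : k.val < m)
    (hl : l ≠ Fin.rev 0) :
    ⁅atU (gaussE T 0 j), atV (schur T 1 k l)⁆ =
      atV (schur T 1 k j) * divDiff 0 (gaussE T 0 l) -
        (if l = j.rev then
          rowPairing (schur T 1 k) (fun p => divDiff (kappa m + 1) (gaussE T 0 p)) else 0) := by
  have hm : 0 < m := j.val.zero_le.trans_lt hj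
  have isUnit_T : IsUnit (atU (T 0 0)) :=
    isUnit_atU ((hT.constantCoeff_eq 0 0).trans (if_pos rfl))
  have leibniz : atU (T 0 0) * ⁅atU (gaussE T 0 j), atV (schur T 1 k l)⁆ =
      ⁅atU (T 0 j), atV (schur T 1 k l)⁆ := by
    rw [← mul_gaussE_zero hT.constantCoeff_eq j, atU_mul, Ring.lie_def, Ring.lie_def, mul_sub,
      (hT.commute_atU_schur hm hk hl).left_comm, mul_assoc]
  have pairing_eq : monUV A *
        (if l = j.rev then rowPairing (schur T 1 k) (fun p => atU (T 0 p)) else 0) =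
      linUV A (kappa m) * (atU (T 0 0) * (if l = j.rev then
        rowPairing (schur T 1 k) (fun p => divDiff (kappa m + 1) (gaussE T 0 p)) else 0)) := by
    split_ifs
    · have h := hT.linUV_mul_lie_zero_schur hm hk (l := Fin.rev 0)
      rw [if_pos rfl, hT.lie_atU_schur_rev_zero hm hk, mul_neg, neg_inj] at h
      exact h.symm
    · simp only [mul_zero]
  refine isUnit_T.mul_left_cancel (isLeftRegular_linUV (kappa m) ?_)
  beta_reduce
  rw [leibniz, hT.linUV_mul_lie_schur hj hk, pairing_eq, ← mul_sub, mul_sub (atU (T 0 0)),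
    (hT.commute_atU_schur hm hk (ne_rev_of_lt hj (j := 0) hm)).left_comm]

theorem lie_atU_gaussE_atV_gaussE (hT : IsGeneratorMatrix m T) (hj : j.val < m) (hj₀ : j ≠ 0) :
    ⁅atU (gaussE T 0 j), atV (gaussE T 1 j.rev)⁆ =
      atV (gaussE T 1 j) * divDiff 0 (gaussE T 0 j.rev) -
        atV (gaussE T 1 j) * divDiff 0 (gaussE T 0 1) * atV (gaussE T 1 j.rev) -
        ∑ p ∈ Finset.Ioi 0,
          theta m p • (atV (gaussE T 1 p.rev) * divDiff (kappa m + 1) (gaussE T 0 p)) := by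
  rw [← rowPairing_divDiff_gaussE_zero hT.constantCoeff_eq (gaussE T 1)]
  have hT₁ := hT.constantCoeff_eq
  have j_pos : 0 < j.val := Nat.pos_of_ne_zero (Fin.val_ne_zero_iff.mpr hj₀)
  have hm : 0 < m := j_pos.trans hj
  have one_lt : (1 : Fin (2 * m + 1)).val < m := (val_one_eq hm).trans_lt (by omega)
  have schur_eq (p : Fin (2 * m + 1)) : schur T 1 1 p = gaussH T 1 * gaussE T 1 p := by
    rw [gaussH_mul_gaussE T hT₁, val_one_eq hm]
  have lie_schur {l : Fin (2 * m + 1)} (hl : l ≠ Fin.rev 0) := hT.lie_atU_gaussE_schur hj one_lt hl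
  have lie_gaussH := lie_schur (ne_rev_of_lt (j := 0) one_lt hm)
  have lie_rev := lie_schur (Fin.rev_injective.ne hj₀)
  rw [if_neg (ne_rev_of_lt one_lt hj), sub_zero, schur_eq 1] at lie_gaussH
  rw [if_pos rfl, schur_eq j.rev, funext schur_eq, rowPairing_mul_left] at lie_rev
  rw [gaussE_diag hT₁, mul_one] at lie_gaussH
  refine (isUnit_atV (constantCoeff_gaussH T hT₁ 1)).mul_left_cancel ?_
  calc atV (gaussH T 1) * ⁅atU (gaussE T 0 j), atV (gaussE T 1 j.rev)⁆
    _ = ⁅atU (gaussE T 0 j), atV (gaussH T 1 * gaussE T 1 j.rev)⁆ -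
        ⁅atU (gaussE T 0 j), atV (gaussH T 1)⁆ * atV (gaussE T 1 j.rev) := by
      simp only [Ring.lie_def, atV_mul]
      noncomm_ring
    _ = _ := by
      rw [lie_rev, lie_gaussH, schur_eq, atV_mul]
      noncomm_ring

theorem coeff_one_lie_atU_gaussE_atV_gaussE (hT : IsGeneratorMatrix m T) (hj : j.val < m)
    (hj₀ : j ≠ 0) :
    coeff 1 ⁅atU (gaussE T 0 j), atV (gaussE T 1 j.rev)⁆ =
      gaussE T 1 j * gaussE T 0 1 * gaussE T 1 j.rev - gaussE T 1 j * gaussE T 0 j.rev +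
        ∑ p ∈ Finset.Ioi 0,
          theta m p • (gaussE T 1 p.rev * shift (kappa m + 1) (gaussE T 0 p)) := by
  have hm : 0 < m := j.val.zero_le.trans_lt hj
  have one_pos : (0 : Fin (2 * m + 1)) < 1 :=
    Fin.lt_def.mpr (Nat.one_pos.trans_eq (val_one_eq hm).symm)
  have j_rev_pos : 0 < j.rev := Fin.pos_iff_ne_zero.mpr (ne_rev_of_lt (i := 0) hm hj).symm
  have coeff_one_term {p : Fin (2 * m + 1)} (hp : 0 < p) (c : ℂ) (f : A⟦X⟧) :=
    coeff_one_atV_mul_divDiff c f (constantCoeff_gaussE_of_lt hT.constantCoeff_eq hp)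
  have coeff_one_sum : coeff 1 (∑ p ∈ Finset.Ioi 0,
        theta m p • (atV (gaussE T 1 p.rev) * divDiff (kappa m + 1) (gaussE T 0 p))) =
      -∑ p ∈ Finset.Ioi 0,
        theta m p • (gaussE T 1 p.rev * shift (kappa m + 1) (gaussE T 0 p)) := by
    rw [map_sum, ← Finset.sum_neg_distrib]
    refine Finset.sum_congr rfl fun p hp => ?_
    rw [← coeff_zsmul', coeff_one_term (Finset.mem_Ioi.mp hp), smul_neg]
  rw [hT.lie_atU_gaussE_atV_gaussE hj hj₀, map_sub, map_sub, coeff_one_sum,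
    coeff_one_term j_rev_pos, atV.eq_def (gaussE T 1 j.rev), coeff_mul_C, coeff_one_term one_pos,
    shift_zero_left, shift_zero_left]
  noncomm_ring

end IsGeneratorMatrix

end GeneratorMatrix

section SuperCommutator

variable {m : ℕ} {j : Fin (2 * m + 1)}

theorem sbr_of_even {a : XOsp m} (ha : parity m a = a) (b : XOsp m) : sbr a b = ⁅a, b⁆ := by
  have evenPart_eq : evenPart a = a := by
    rw [evenPart, ha, ← two_smul ℂ a, smul_smul]
    norm_num
  rw [sbr, evenPart_eq, oddPart, ha, sub_self, smul_zero, mul_zero, add_zero, Ring.lie_def]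

theorem sbrSer_of_even {f : (XOsp m)⟦X⟧}
    (hf : PowerSeries.map (parity m : XOsp m →+* XOsp m) f = f) (g : (XOsp m)⟦X⟧) :
    sbrSer f g = ⁅atU f, atV g⁆ := by
  ext r s
  have coeff_even : parity m (coeff r f) = coeff r f := by
    conv_rhs => rw [← hf, coeff_map]
    rfl
  have coeff_sbrSer : coeff s (coeff r (sbrSer f g)) = sbr (coeff r f) (coeff s g) := by
    rw [sbrSer, coeff_mk, sbrElt, coeff_mk]
  rw [coeff_sbrSer, sbr_of_even coeff_even, Ring.lie_def, Ring.lie_def,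
    map_sub, map_sub, atU, atV, coeff_mul_C, coeff_C_mul, coeff_map, coeff_C_mul, coeff_mul_C]

theorem map_parity_tSer (i j : Fin (2 * m + 1)) :
    PowerSeries.map (parity m : XOsp m →+* XOsp m) (tSer m i j) =
      ((-1 : ℤ) ^ (bar m i + bar m j)) • tSer m i j := by
  ext r
  rw [coeff_map, ← coeff_zsmul']
  exact parity_coeff_tSer m i j r

theorem map_parity_eSer_zero (j : Fin (2 * m + 1)) :
    PowerSeries.map (parity m : XOsp m →+* XOsp m) (eSer m 0 j) =
      ((-1 : ℤ) ^ (bar m 0 + bar m j)) • eSer m 0 j := by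
  have tSer_mul_eSer : tSer m 0 0 * eSer m 0 j = tSer m 0 j :=
    mul_gaussE_zero (constantCoeff_tMat m) j
  have isUnit_tSer : IsUnit (tSer m 0 0) := by
    rw [isUnit_iff_constantCoeff]
    exact ((constantCoeff_tMat m 0 0).trans (if_pos rfl)) ▸ isUnit_one
  have tSer_even : PowerSeries.map (parity m : XOsp m →+* XOsp m) (tSer m 0 0) = tSer m 0 0 := by
    rw [map_parity_tSer, ← two_mul, pow_mul, neg_one_sq, one_pow, one_smul]
  refine isUnit_tSer.mul_left_cancel ?_
  calc tSer m 0 0 * PowerSeries.map (parity m : XOsp m →+* XOsp m) (eSer m 0 j)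
    _ = PowerSeries.map (parity m : XOsp m →+* XOsp m) (tSer m 0 j) := by
      rw [← tSer_mul_eSer, map_mul, tSer_even]
    _ = _ := by rw [map_parity_tSer, ← tSer_mul_eSer, mul_smul_comm]

theorem sbrSer_eSer_zero (hj : j.val < m) (g : (XOsp m)⟦X⟧) :
    sbrSer (eSer m 0 j) g = ⁅atU (eSer m 0 j), atV g⁆ := by
  have hm : 0 < m := j.val.zero_le.trans_lt hj
  have bar_zero : bar m 0 = 1 := if_neg hm.ne
  have bar_eq : bar m j = 1 := if_neg hj.ne
  refine sbrSer_of_even ?_ g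
  rw [map_parity_eSer_zero, bar_zero, bar_eq, one_add_one_eq_two, neg_one_sq, one_smul]

end SuperCommutator

theorem sum_Ioi_theta_two {M : Type*} [AddCommGroup M] (f : Fin (2 * 2 + 1) → M) :
    ∑ p ∈ Finset.Ioi 0, theta 2 p • f p = f 1 + f 2 - f 3 - f 4 := by
  calc ∑ p ∈ Finset.Ioi 0, theta 2 p • f p
    _ = (1 : ℤ) • f 1 + ((1 : ℤ) • f 2 + ((-1 : ℤ) • f 3 + ((-1 : ℤ) • f 4 + 0))) := rfl
    _ = f 1 + f 2 - f 3 - f 4 := by abel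

theorem kappa_two_add_one : kappa 2 + 1 = -3 / 2 := by
  norm_num [kappa]

end OspYangian

theorem corollary5p3_general {m : ℕ} {j : Fin (2 * m + 1)} (hj : j.val < m) (hj₀ : j ≠ 0) :
    (sbrElt (coeff 1 (eSer m 0 j)) (eSer m 1 j.rev) =
      eSer m 1 j * eSer m 0 1 * eSer m 1 j.rev - eSer m 1 j * eSer m 0 j.rev +
        ∑ p ∈ Finset.Ioi 0,
          theta m p • (eSer m 1 p.rev * shift (kappa m + 1) (eSer m 0 p))) ∧
    (sbrSer (eSer m 0 j) (eSer m 1 j.rev) =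
      atV (eSer m 1 j) * divDiff 0 (eSer m 0 j.rev) -
        atV (eSer m 1 j) * divDiff 0 (eSer m 0 1) * atV (eSer m 1 j.rev) -
        ∑ p ∈ Finset.Ioi 0,
          theta m p • (atV (eSer m 1 p.rev) * divDiff (kappa m + 1) (eSer m 0 p))) := by
  have generator := isGeneratorMatrix_tMat m
  have coeff_sbrSer : sbrElt (coeff 1 (eSer m 0 j)) (eSer m 1 j.rev) =
      coeff 1 (sbrSer (eSer m 0 j) (eSer m 1 j.rev)) := by rw [sbrSer, coeff_mk]
  rw [coeff_sbrSer, sbrSer_eSer_zero hj]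
  exact ⟨generator.coeff_one_lie_atU_gaussE_atV_gaussE hj hj₀,
    generator.lie_atU_gaussE_atV_gaussE hj hj₀⟩

theorem corollary5p3 :
    (sbrElt (coeff 1 (eSer 2 0 1)) (eSer 2 1 (Fin.rev 1)) =
      eSer 2 0 1 * eSer 2 1 (Fin.rev 1) - eSer 2 0 (Fin.rev 1) -
        shift (-3 / 2) (eSer 2 0 (Fin.rev 1)) +
        eSer 2 1 2 * shift (-3 / 2) (eSer 2 0 2) +
        eSer 2 1 (Fin.rev 1) * shift (-3 / 2) (eSer 2 0 1)) ∧
    (sbrSer (eSer 2 0 1) (eSer 2 1 (Fin.rev 1)) =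
      - divDiff 0 (eSer 2 0 1) * atV (eSer 2 1 (Fin.rev 1)) +
        divDiff 0 (eSer 2 0 (Fin.rev 1)) + divDiff (-3 / 2) (eSer 2 0 (Fin.rev 1)) -
        atV (eSer 2 1 2) * divDiff (-3 / 2) (eSer 2 0 2) -
        atV (eSer 2 1 (Fin.rev 1)) * divDiff (-3 / 2) (eSer 2 0 1)) := by
  obtain ⟨coeff_one_eq, series_eq⟩ :=
    corollary5p3_general (m := 2) (j := 1) (by decide) (by decide)
  have eSer_diag : eSer 2 1 1 = 1 := gaussE_diag (constantCoeff_tMat 2) 1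
  have eSer_lower : eSer 2 1 (Fin.rev 4) = 0 :=
    (isGauss_gauss _ (constantCoeff_tMat 2)).E_lower 1 0 (by decide)
  have rev_one : Fin.rev 1 = (3 : Fin (2 * 2 + 1)) := rfl
  have rev_two : Fin.rev 2 = (2 : Fin (2 * 2 + 1)) := rfl
  have rev_three : Fin.rev 3 = (1 : Fin (2 * 2 + 1)) := rfl
  rw [kappa_two_add_one, sum_Ioi_theta_two, eSer_lower, rev_three, eSer_diag]
    at coeff_one_eq series_eq
  rw [one_mul, one_mul, one_mul, zero_mul] at coeff_one_eq
  rw [atV_one, atV_zero, one_mul, one_mul, one_mul, zero_mul] at series_eq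
  constructor
  · rw [coeff_one_eq, rev_one, rev_two]
    abel
  · rw [series_eq, rev_one, rev_two, neg_mul (divDiff 0 (eSer 2 0 1))]
    abel
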